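/- Work in dependent type theory with $\Pi$-types, $\Sigma$-types (with their dependent eliminator), intensional identity types $a=_A b$ (with the eliminator $J$), a cumulative hierarchy of universes $\mathcal U_0:\mathcal U_1:\dots$, and function extensionality. This is a fragment of homotopy type theory; uniqueness of identity proofs is not available. "The closed type $T$ has an element" means that $\vdash t:T$ is derivable for some term $t$. Let $\mathsf{isProp}(A):\equiv\Pi(x,y:A).\,x=y$, $\mathsf{isContr}(A):\equiv\Sigma(c:A).\Pi(x:A).\,c=x$, and call $f:A\to B$ an *equivalence of types* if $\Pi(b:B).\,\mathsf{isContr}(\Sigma(a:A).\,f(a)=b)$; then $f^{-1}(b):A$ is the first component of the centre of contraction. A *wild semicategory* $C$ consists of $\mathsf{Ob}:\mathcal U_i$, $\hom:\mathsf{Ob}\to\mathsf{Ob}\to\mathcal U_j$, a composition $\circ:\Pi(x,y,z:\mathsf{Ob}).\,\hom(y,z)\to\hom(x,y)\to\hom(x,z)$, and a witness $\mathsf{assoc}$ of $(h\circ g)\circ f=h\circ(g\circ f)$ for all composable $h,g,f$; nothing is assumed about the truncation levels of $\mathsf{Ob}$ and $\hom$. For $e:\hom(x,y)$ let $\mathsf{iseqv}(e)$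 be the product of the two types stating that, for every $z:\mathsf{Ob}$, the map $(-\circ e):\hom(y,z)\to\hom(x,z)$ is an equivalence of types and that, for every $w:\mathsf{Ob}$, the map $(e\circ -):\hom(w,x)\to\hom(w,y)$ is an equivalence of types. A *good identity* on $x$ is an $i:\hom(x,x)$ with an element of $\mathsf{iseqv}(i)\times(i\circ i=i)$, and $$\mathsf{hasGoodIdStruc}(C):\equiv\Pi(x:\mathsf{Ob}).\,\Sigma(i:\hom(x,x)).\,\mathsf{iseqv}(i)\times(i\circ i=i).$$ **Theorem.** For all universe levels $i,j$, each of the following types, universally quantified over all wild semicategories $C$ (with $\mathsf{Ob}:\mathcal U_i$ and $\hom$ valued in $\mathcal U_j$), has an element. 1. $\mathsf{isProp}(\mathsf{hasGoodIdStruc}(C))$; that is, having a good identity structure is a proposition. 2. For every $x:\mathsf{Ob}$ and $i:\hom(x,x)$, functions in both directions between the type that $i$ is a good identity and the type that $i$ is two-sided neutral, i.e. $\big(\Pi(w:\mathsf{Ob})(f:\hom(w,x)).\,i\circ f=f\big)\times\big(\Pi(y:\mathsf{Ob})(g:\hom(x,y)).\,g\circ i=g\big)$. 3. For all $x,y:\mathsf{Ob}$,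 $e:\hom(x,y)$ and $p:\mathsf{iseqv}(e)$, the type that $I(e):\equiv(e\circ -)^{-1}(e):\hom(x,x)$ is a good identity on $x$. -/

import Mathlib

/-! Lean's own equality is proof-irrelevant, so that every Lean type satisfies uniqueness of
identity proofs.  The type theory in which the result lives is therefore represented by its
terms and derivations: dependent type theory with `Π`, `Σ`, intensional identity types, a
cumulative hierarchy of universes, and function extensionality.  There is no rule that would
give uniqueness of identity proofs.  All of it is part of homotopy type theory. -/

namespace TypeTheory

/-- Raw terms (and types), with de Bruijn indices.  The arguments marked `[k]` stand under `k`
binders, the innermost one being `var 0`. -/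
inductive Tm : Type where
  /-- a variable -/
  | var (n : ℕ) : Tm
  /-- the universe `U_i` -/
  | univ (i : ℕ) : Tm
  /-- `Π (x : A), B`, with `B[1]` -/
  | pi (A B : Tm) : Tm
  /-- `λ (x : A), b`, with `b[1]` -/
  | lam (A b : Tm) : Tm
  /-- `f a` -/
  | app (f a : Tm) : Tm
  /-- `Σ (x : A), B`, with `B[1]` -/
  | sig (A B : Tm) : Tm
  /-- `(a, b) : Σ (x : A), B`, with `B[1]` -/
  | pair (A B a b : Tm) : Tm
  /-- the eliminator of `Σ`: `ind (z. C) (x y. d) p`, with `C[1]` and `d[2]` -/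
  | split (C d p : Tm) : Tm
  /-- the identity type `a =_A b` -/
  | idt (A a b : Tm) : Tm
  /-- `refl_a : a =_A a` -/
  | refl (a : Tm) : Tm
  /-- the (based) eliminator `J` of the identity type: `J (y q. C) d p`, with `C[2]` -/
  | idrec (C d p : Tm) : Tm
  /-- function extensionality: an equality `f = g` from a pointwise equality `h` -/
  | funext (f g h : Tm) : Tm

namespace Tm

/-- Extension of a renaming under one binder. -/
def upr (ρ : ℕ → ℕ) : ℕ → ℕ
  | 0 => 0
  | n + 1 => ρ n + 1

/-- Renaming of variables. -/
def ren : (ℕ → ℕ) → Tm → Tm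
  | ρ, var n => var (ρ n)
  | _, univ i => univ i
  | ρ, pi A B => pi (ren ρ A) (ren (upr ρ) B)
  | ρ, lam A b => lam (ren ρ A) (ren (upr ρ) b)
  | ρ, app f a => app (ren ρ f) (ren ρ a)
  | ρ, sig A B => sig (ren ρ A) (ren (upr ρ) B)
  | ρ, pair A B a b => pair (ren ρ A) (ren (upr ρ) B) (ren ρ a) (ren ρ b)
  | ρ, split C d p => split (ren (upr ρ) C) (ren (upr (upr ρ)) d) (ren ρ p)
  | ρ, idt A a b => idt (ren ρ A) (ren ρ a) (ren ρ b)
  | ρ, refl a => refl (ren ρ a)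
  | ρ, idrec C d p => idrec (ren (upr (upr ρ)) C) (ren ρ d) (ren ρ p)
  | ρ, funext f g h => funext (ren ρ f) (ren ρ g) (ren ρ h)

/-- Weakening by `k` variables: `t.wk k` is `t` read under `k` further binders. -/
def wk (k : ℕ) (t : Tm) : Tm := ren (fun n => n + k) t

/-- Extension of a substitution under one binder. -/
def ups (σ : ℕ → Tm) : ℕ → Tm
  | 0 => var 0
  | n + 1 => wk 1 (σ n)

/-- Simultaneous (capture-avoiding) substitution. -/
def subst : (ℕ → Tm) → Tm → Tm
  | σ, var n => σ n
  | _, univ i => univ i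
  | σ, pi A B => pi (subst σ A) (subst (ups σ) B)
  | σ, lam A b => lam (subst σ A) (subst (ups σ) b)
  | σ, app f a => app (subst σ f) (subst σ a)
  | σ, sig A B => sig (subst σ A) (subst (ups σ) B)
  | σ, pair A B a b => pair (subst σ A) (subst (ups σ) B) (subst σ a) (subst σ b)
  | σ, split C d p => split (subst (ups σ) C) (subst (ups (ups σ)) d) (subst σ p)
  | σ, idt A a b => idt (subst σ A) (subst σ a) (subst σ b)
  | σ, refl a => refl (subst σ a)
  | σ, idrec C d p => idrec (subst (ups (ups σ)) C) (subst σ d) (subst σ p)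
  | σ, funext f g h => funext (subst σ f) (subst σ g) (subst σ h)

/-- The substitution `0 ↦ a`, `n + 1 ↦ σ n`. -/
def scons (a : Tm) (σ : ℕ → Tm) : ℕ → Tm
  | 0 => a
  | n + 1 => σ n

/-- `t[a/x]`, for `t` under one binder `x`. -/
def inst (t a : Tm) : Tm := subst (scons a var) t

/-- `t[a/x, b/y]`, for `t` under two binders `x`, `y` (so `x` is `var 1` and `y` is `var 0`). -/
def inst₂ (t a b : Tm) : Tm := subst (scons b (scons a var)) t

/-- For `C` under a binder `z : Σ (x : A), B`, the type `C[(x, y)/z]` under two binders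
`x : A`, `y : B`. -/
def instPair (A B C : Tm) : Tm :=
  subst (scons (pair (wk 2 A) (ren (upr (fun n => n + 2)) B) (var 1) (var 0))
    (fun n => var (n + 2))) C

end Tm

open Tm

/-- Judgmental equality: the congruence generated by the computation rules of `Π`, `Σ` and
identity types. -/
inductive Conv : Tm → Tm → Prop
  | rfl (t : Tm) : Conv t t
  | symm {s t : Tm} : Conv s t → Conv t s
  | trans {s t u : Tm} : Conv s t → Conv t u → Conv s u
  | beta (A b a : Tm) : Conv (app (lam A b) a) (inst b a)
  | split_pair (C d A B a b : Tm) : Conv (split C d (pair A B a b)) (inst₂ d a b)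
  | idrec_refl (C d a : Tm) : Conv (idrec C d (refl a)) d
  | pi {A A' B B' : Tm} : Conv A A' → Conv B B' → Conv (pi A B) (pi A' B')
  | lam {A A' b b' : Tm} : Conv A A' → Conv b b' → Conv (lam A b) (lam A' b')
  | app {f f' a a' : Tm} : Conv f f' → Conv a a' → Conv (app f a) (app f' a')
  | sig {A A' B B' : Tm} : Conv A A' → Conv B B' → Conv (sig A B) (sig A' B')
  | pair {A A' B B' a a' b b' : Tm} : Conv A A' → Conv B B' → Conv a a' → Conv b b' →
      Conv (pair A B a b) (pair A' B' a' b')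
  | split {C C' d d' p p' : Tm} : Conv C C' → Conv d d' → Conv p p' →
      Conv (split C d p) (split C' d' p')
  | idt {A A' a a' b b' : Tm} : Conv A A' → Conv a a' → Conv b b' →
      Conv (idt A a b) (idt A' a' b')
  | refl {a a' : Tm} : Conv a a' → Conv (refl a) (refl a')
  | idrec {C C' d d' p p' : Tm} : Conv C C' → Conv d d' → Conv p p' →
      Conv (idrec C d p) (idrec C' d' p')
  | funext {f f' g g' h h' : Tm} : Conv f f' → Conv g g' → Conv h h' →
      Conv (funext f g h) (funext f' g' h')

/-- `HasVar Γ n A`: the `n`-th variable of the context `Γ` is declared with type `A` (weakened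
to `Γ`).  The head of the list is the variable declared last. -/
inductive HasVar : List Tm → ℕ → Tm → Prop
  | zero (Γ : List Tm) (A : Tm) : HasVar (A :: Γ) 0 (wk 1 A)
  | succ {Γ : List Tm} {n : ℕ} {A : Tm} (B : Tm) : HasVar Γ n A →
      HasVar (B :: Γ) (n + 1) (wk 1 A)

/-- The typing judgment `Γ ⊢ t : A`, for contexts `Γ` that are well formed, such as the empty
one.  (Each rule extends a context only by a type over it.)  `A` is a type over `Γ` if
`Γ ⊢ A : U_i` for some `i`. -/
inductive HasType : List Tm → Tm → Tm → Prop
  | var {Γ : List Tm} {n : ℕ} {A : Tm} : HasVar Γ n A → HasType Γ (var n) A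
  | conv {Γ : List Tm} {t A B : Tm} {i : ℕ} :
      HasType Γ t A → HasType Γ B (univ i) → Conv A B → HasType Γ t B
  | univ (Γ : List Tm) (i : ℕ) : HasType Γ (univ i) (univ (i + 1))
  | cumul {Γ : List Tm} {A : Tm} {i : ℕ} :
      HasType Γ A (univ i) → HasType Γ A (univ (i + 1))
  | pi {Γ : List Tm} {A B : Tm} {i : ℕ} :
      HasType Γ A (univ i) → HasType (A :: Γ) B (univ i) → HasType Γ (pi A B) (univ i)
  | lam {Γ : List Tm} {A B b : Tm} {i : ℕ} :
      HasType Γ A (univ i) → HasType (A :: Γ) b B → HasType Γ (lam A b) (pi A B)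
  | app {Γ : List Tm} {A B f a : Tm} :
      HasType Γ f (pi A B) → HasType Γ a A → HasType Γ (app f a) (inst B a)
  | sig {Γ : List Tm} {A B : Tm} {i : ℕ} :
      HasType Γ A (univ i) → HasType (A :: Γ) B (univ i) → HasType Γ (sig A B) (univ i)
  | pair {Γ : List Tm} {A B a b : Tm} {i : ℕ} :
      HasType Γ A (univ i) → HasType (A :: Γ) B (univ i) →
      HasType Γ a A → HasType Γ b (inst B a) → HasType Γ (pair A B a b) (sig A B)
  | split {Γ : List Tm} {A B C d p : Tm} {i : ℕ} :
      HasType (sig A B :: Γ) C (univ i) → HasType (B :: A :: Γ) d (instPair A B C) →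
      HasType Γ p (sig A B) → HasType Γ (split C d p) (inst C p)
  | idt {Γ : List Tm} {A a b : Tm} {i : ℕ} :
      HasType Γ A (univ i) → HasType Γ a A → HasType Γ b A → HasType Γ (idt A a b) (univ i)
  | refl {Γ : List Tm} {A a : Tm} :
      HasType Γ a A → HasType Γ (refl a) (idt A a a)
  | idrec {Γ : List Tm} {A a b C d p : Tm} {i : ℕ} :
      HasType (idt (wk 1 A) (wk 1 a) (var 0) :: A :: Γ) C (univ i) →
      HasType Γ d (inst₂ C a (refl a)) → HasType Γ p (idt A a b) →
      HasType Γ (idrec C d p) (inst₂ C b p)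
  | funext {Γ : List Tm} {A B f g h : Tm} :
      HasType Γ f (pi A B) → HasType Γ g (pi A B) →
      HasType Γ h (pi A (idt B (app (wk 1 f) (var 0)) (app (wk 1 g) (var 0)))) →
      HasType Γ (funext f g h) (idt (pi A B) f g)

/-- The closed type `T` has an element. -/
def Inhabited (T : Tm) : Prop := ∃ t : Tm, HasType [] t T

/-! ### Basic notions of homotopy type theory, as terms over an arbitrary context -/

/-- `A → B` -/
def arrow (A B : Tm) : Tm := pi A (wk 1 B)

/-- `A × B` -/
def prod (A B : Tm) : Tm := sig A (wk 1 B)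

/-- First projection of an element of `Σ (x : A), B`. -/
def fst (A p : Tm) : Tm := split (wk 1 A) (var 1) p

/-- Second projection of an element of `A × B`. -/
def snd (B p : Tm) : Tm := split (wk 1 B) (var 0) p

/-- `Π (x y : A), x = y` -/
def isProp (A : Tm) : Tm := pi A (pi (wk 1 A) (idt (wk 2 A) (var 1) (var 0)))

/-- `Σ (c : A), Π (x : A), c = x` -/
def isContr (A : Tm) : Tm := sig A (pi (wk 1 A) (idt (wk 2 A) (var 1) (var 0)))

/-- `Σ (a : A), f a = b`, for `f : A → B` and `b : B` -/
def fiber (A B f b : Tm) : Tm := sig A (idt (wk 1 B) (app (wk 1 f) (var 0)) (wk 1 b))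

/-- `f : A → B` is an equivalence of types: `Π (b : B), isContr (fiber f b)`. -/
def isEquiv (A B f : Tm) : Tm := pi B (isContr (fiber (wk 1 A) (wk 1 B) (wk 1 f) (var 0)))

/-- `f⁻¹ b`, for `f : A → B` with `p : isEquiv f` -/
def inverse (A B f p b : Tm) : Tm := fst A (fst (fiber A B f b) (app p b))

/-! ### Wild semicategories -/

/-- `Ob`, `hom` and composition of a wild semicategory over some context. -/
structure Semicat : Type where
  ob : Tm
  hom : Tm
  comp : Tm

namespace Semicat

/-- Weakening by `k` variables. -/
def wk (k : ℕ) (C : Semicat) : Semicat := ⟨C.ob.wk k, C.hom.wk k, C.comp.wk k⟩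

/-- `hom(x, y)` -/
def Hom (C : Semicat) (x y : Tm) : Tm := app (app C.hom x) y

/-- `g ∘ f : hom(x, z)`, for `f : hom(x, y)` and `g : hom(y, z)` -/
def cmp (C : Semicat) (x y z g f : Tm) : Tm :=
  app (app (app (app (app C.comp x) y) z) g) f

/-- `(– ∘ e) : hom(y, z) → hom(x, z)`, for `e : hom(x, y)` -/
def precomp (C : Semicat) (x y z e : Tm) : Tm :=
  lam (C.Hom y z) ((C.wk 1).cmp (x.wk 1) (y.wk 1) (z.wk 1) (var 0) (e.wk 1))

/-- `(e ∘ –) : hom(w, x) → hom(w, y)`, for `e : hom(x, y)` -/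
def postcomp (C : Semicat) (w x y e : Tm) : Tm :=
  lam (C.Hom w x) ((C.wk 1).cmp (w.wk 1) (x.wk 1) (y.wk 1) (e.wk 1) (var 0))

/-- `Π (z : Ob), isEquiv (– ∘ e : hom(y, z) → hom(x, z))` -/
def preEquiv (C : Semicat) (x y e : Tm) : Tm :=
  pi C.ob (isEquiv ((C.wk 1).Hom (y.wk 1) (var 0)) ((C.wk 1).Hom (x.wk 1) (var 0))
    ((C.wk 1).precomp (x.wk 1) (y.wk 1) (var 0) (e.wk 1)))

/-- `Π (w : Ob), isEquiv (e ∘ – : hom(w, x) → hom(w, y))` -/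
def postEquiv (C : Semicat) (x y e : Tm) : Tm :=
  pi C.ob (isEquiv ((C.wk 1).Hom (var 0) (x.wk 1)) ((C.wk 1).Hom (var 0) (y.wk 1))
    ((C.wk 1).postcomp (var 0) (x.wk 1) (y.wk 1) (e.wk 1)))

/-- `iseqv(e)`: the morphism `e : hom(x, y)` is an equivalence. -/
def isEqv (C : Semicat) (x y e : Tm) : Tm := prod (C.preEquiv x y e) (C.postEquiv x y e)

/-- The morphism `i : hom(x, x)` is a good identity: `iseqv(i) × (i ∘ i = i)`. -/
def isGoodId (C : Semicat) (x i : Tm) : Tm :=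
  prod (C.isEqv x x i) (idt (C.Hom x x) (C.cmp x x x i i) i)

/-- `Π (x : Ob), Σ (i : hom(x, x)), iseqv(i) × (i ∘ i = i)` -/
def hasGoodIdStruc (C : Semicat) : Tm :=
  pi C.ob (sig ((C.wk 1).Hom (var 0) (var 0)) ((C.wk 2).isGoodId (var 1) (var 0)))

/-- `i : hom(x, x)` is two-sided neutral:
`(Π (w : Ob) (f : hom(w, x)), i ∘ f = f) × (Π (y : Ob) (g : hom(x, y)), g ∘ i = g)`. -/
def isNeutral (C : Semicat) (x i : Tm) : Tm :=
  prod
    (pi C.ob (pi ((C.wk 1).Hom (var 0) (x.wk 1))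
      (idt ((C.wk 2).Hom (var 1) (x.wk 2))
        ((C.wk 2).cmp (var 1) (x.wk 2) (x.wk 2) (i.wk 2) (var 0)) (var 0))))
    (pi C.ob (pi ((C.wk 1).Hom (x.wk 1) (var 0))
      (idt ((C.wk 2).Hom (x.wk 2) (var 1))
        ((C.wk 2).cmp (x.wk 2) (x.wk 2) (var 1) (var 0) (i.wk 2)) (var 0))))

/-- `I(e) = (e ∘ –)⁻¹ e : hom(x, x)`, for `e : hom(x, y)` with `p : iseqv(e)` -/
def I (C : Semicat) (x y e p : Tm) : Tm :=
  inverse (C.Hom x x) (C.Hom x y) (C.postcomp x x y e)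
    (app (snd (C.postEquiv x y e) p) x) e

/-- `Π (x : Ob) (i : hom(x, x)), (isGoodId i → isNeutral i) × (isNeutral i → isGoodId i)` -/
def goodIdIffNeutral (C : Semicat) : Tm :=
  pi C.ob (pi ((C.wk 1).Hom (var 0) (var 0))
    (prod
      (arrow ((C.wk 2).isGoodId (var 1) (var 0)) ((C.wk 2).isNeutral (var 1) (var 0)))
      (arrow ((C.wk 2).isNeutral (var 1) (var 0)) ((C.wk 2).isGoodId (var 1) (var 0)))))

/-- `Π (x y : Ob) (e : hom(x, y)) (p : iseqv(e)), isGoodId (I e)` -/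
def goodIdOfEqv (C : Semicat) : Tm :=
  pi C.ob (pi (C.wk 1).ob (pi ((C.wk 2).Hom (var 1) (var 0))
    (pi ((C.wk 3).isEqv (var 2) (var 1) (var 0))
      ((C.wk 4).isGoodId (var 3) ((C.wk 4).I (var 3) (var 2) (var 1) (var 0))))))

end Semicat

/-- `Π (x y z : Ob), hom(y, z) → hom(x, y) → hom(x, z)` -/
def compType (ob hom : Tm) : Tm :=
  let H (k : ℕ) (x y : Tm) : Tm := app (app (wk k hom) x) y
  pi ob (pi (wk 1 ob) (pi (wk 2 ob)
    (arrow (H 3 (var 1) (var 0)) (arrow (H 3 (var 2) (var 1)) (H 3 (var 2) (var 0))))))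

/-- `Π (w x y z : Ob) (h : hom(y, z)) (g : hom(x, y)) (f : hom(w, x)), (h ∘ g) ∘ f = h ∘ (g ∘ f)` -/
def assocType (C : Semicat) : Tm :=
  pi C.ob (pi (C.wk 1).ob (pi (C.wk 2).ob (pi (C.wk 3).ob
    (pi ((C.wk 4).Hom (var 1) (var 0))
      (pi ((C.wk 5).Hom (var 3) (var 2))
        (pi ((C.wk 6).Hom (var 5) (var 4))
          (idt ((C.wk 7).Hom (var 6) (var 3))
            ((C.wk 7).cmp (var 6) (var 5) (var 3)
              ((C.wk 7).cmp (var 5) (var 4) (var 3) (var 2) (var 1)) (var 0))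
            ((C.wk 7).cmp (var 6) (var 4) (var 3) (var 2)
              ((C.wk 7).cmp (var 6) (var 5) (var 4) (var 1) (var 0))))))))))

/-- `Π (Ob : U_i) (hom : Ob → Ob → U_j) (comp : …) (assoc : …), T C`, where
`C = (Ob, hom, comp)` is the generic wild semicategory over this context of four variables. -/
def forallSemicat (i j : ℕ) (T : Semicat → Tm) : Tm :=
  pi (univ i)
    (pi (arrow (var 0) (arrow (var 0) (univ j)))
      (pi (compType (var 1) (var 0))
        (pi (assocType ⟨var 2, var 1, var 0⟩)
          (T ⟨var 3, var 2, var 1⟩))))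

end TypeTheory

namespace TypeTheory

open Tm

/-! ### A type inference algorithm

Universe levels are symbolic in the terms that are checked: `0` and `1` stand for the levels `i`
and `j`, and `n + 2` stands for `max i j + n`. -/

/-! The mathematics rests on one observation: if `e : hom(x, y)` is an equivalence and `e ∘ i = e`,
then `i` is two-sided neutral (`neutralOf`). Indeed `e ∘ (i ∘ f) = (e ∘ i) ∘ f = e ∘ f`, and `e`
cancels; and every `g` out of `x` is some `h ∘ e`, so `g ∘ i = h ∘ (e ∘ i) = h ∘ e = g`. Conversely,
if `i` is neutral, both composition maps equal the identity function by function extensionality,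
hence are equivalences, and `i ∘ i = i` is an instance of neutrality (`goodIdOfNeutral`). The case
`e = i` compares good identities with neutral morphisms; since `e ∘ I(e) = e` by construction,
`I(e)` is good.

For uniqueness, `i ∘ i = i` need not be a proposition for fixed `i`, so this equation has to be
compared together with `i`. Let `i` and `j` be good, with `q : j ∘ j = j`. Right neutrality of `i`
gives `r j : j ∘ i = j`, so `(i, r j)` and `(j, q)` lie in the contractible fibre of `j ∘ –` over
`j`. A path between them identifies `i` with `j` and `r j` with `q`; by path induction `j` becomes
`i` and `q` becomes `r i`. As `iseqv` is a proposition, every good identity equals the one formed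
from `i` and `r i` (`eqAtGoodId`).

Derivability is shown by explicit terms, accepted by a type checker that is proved sound
(`sound_infer`) and run by the kernel. Levels are symbolic, so one run serves all `i` and `j`. -/

/-- The value of a symbolic universe level. -/
def level (i j : ℕ) : ℕ → ℕ
  | 0 => i
  | 1 => j
  | n + 2 => max i j + n

/-- The order on symbolic levels. -/
def levelLe (a b : ℕ) : Bool := Nat.beq a b || (Nat.ble 2 b && Nat.ble a b)

/-- An upper bound of two symbolic levels. -/
def levelSup (a b : ℕ) : ℕ := bif Nat.beq a b then a else max 2 (max a b)

/-- The symbols `0` and `1` are incomparable, as nothing is known about `i` and `j`; symbols from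
`2` on lie above both. -/
theorem level_le_of_levelLe (i j : ℕ) {a b : ℕ} (h : levelLe a b = true) :
    level i j a ≤ level i j b := by
  simp only [levelLe, Bool.or_eq_true, Bool.and_eq_true, Nat.beq_eq, Nat.ble_eq] at h
  rcases h with rfl | ⟨h2, h⟩
  · exact le_rfl
  · match a, b with
    | 0, b + 2 => simp only [level]; omega
    | 1, b + 2 => simp only [level]; omega
    | a + 2, b + 2 => simp only [level]; omega

theorem levelLe_levelSup_left (a b : ℕ) : levelLe a (levelSup a b) = true := by
  by_cases h : a = b
  · simp [levelLe, levelSup, h]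
  · have : Nat.beq a b = false := Bool.eq_false_iff.2 fun h' => h (Nat.eq_of_beq_eq_true h')
    simp [levelLe, levelSup, this]

theorem levelLe_levelSup_right (a b : ℕ) : levelLe b (levelSup a b) = true := by
  by_cases h : a = b
  · simp [levelLe, levelSup, h]
  · have : Nat.beq a b = false := Bool.eq_false_iff.2 fun h' => h (Nat.eq_of_beq_eq_true h')
    simp [levelLe, levelSup, this]

/-- No symbol denotes `i + 1` or `j + 1`; the universes `0` and `1` are therefore placed in the
universe `3`, that is, `max i j + 1`. -/
theorem level_lt_level_max_add_one (i j a : ℕ) : level i j a < level i j (max a 2 + 1) := by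
  match a with
  | 0 => exact Nat.lt_succ_of_le (le_max_left i j)
  | 1 => exact Nat.lt_succ_of_le (le_max_right i j)
  | a + 2 =>
    have : max (a + 2) 2 + 1 = a + 1 + 2 := by omega
    rw [this]; simp only [level]; omega

/-! ### Change of universe levels, and normalization -/

namespace Tm

/-- Replacement of the universe levels in a term. -/
def relevel (l : ℕ → ℕ) : Tm → Tm
  | var n => var n
  | univ i => univ (l i)
  | pi A B => pi (relevel l A) (relevel l B)
  | lam A b => lam (relevel l A) (relevel l b)
  | app f a => app (relevel l f) (relevel l a)
  | sig A B => sig (relevel l A) (relevel l B)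
  | pair A B a b => pair (relevel l A) (relevel l B) (relevel l a) (relevel l b)
  | split C d p => split (relevel l C) (relevel l d) (relevel l p)
  | idt A a b => idt (relevel l A) (relevel l a) (relevel l b)
  | refl a => refl (relevel l a)
  | idrec C d p => idrec (relevel l C) (relevel l d) (relevel l p)
  | funext f g h => funext (relevel l f) (relevel l g) (relevel l h)

variable (l : ℕ → ℕ)

theorem relevel_ren (ρ : ℕ → ℕ) (t : Tm) : relevel l (ren ρ t) = ren ρ (relevel l t) := by
  induction t generalizing ρ <;> simp_all [ren, relevel]

theorem relevel_wk (k : ℕ) (t : Tm) : relevel l (wk k t) = wk k (relevel l t) :=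
  relevel_ren l _ t

theorem relevel_ups (σ : ℕ → Tm) :
    (fun n => relevel l (ups σ n)) = ups (fun n => relevel l (σ n)) := by
  funext n
  cases n <;> simp [ups, relevel, relevel_wk]

theorem relevel_subst (σ : ℕ → Tm) (t : Tm) :
    relevel l (subst σ t) = subst (fun n => relevel l (σ n)) (relevel l t) := by
  induction t generalizing σ <;> simp_all [subst, relevel, relevel_ups]

theorem relevel_scons (a : Tm) (σ : ℕ → Tm) :
    (fun n => relevel l (scons a σ n)) = scons (relevel l a) (fun n => relevel l (σ n)) := by
  funext n
  cases n <;> rfl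

theorem relevel_inst (t a : Tm) : relevel l (inst t a) = inst (relevel l t) (relevel l a) := by
  simp [inst, relevel_subst, relevel_scons, relevel]

theorem relevel_inst₂ (t a b : Tm) :
    relevel l (inst₂ t a b) = inst₂ (relevel l t) (relevel l a) (relevel l b) := by
  simp [inst₂, relevel_subst, relevel_scons, relevel]

theorem relevel_instPair (A B C : Tm) :
    relevel l (instPair A B C) = instPair (relevel l A) (relevel l B) (relevel l C) := by
  simp [instPair, relevel_subst, relevel_scons, relevel, relevel_wk, relevel_ren]

/-- Syntactic equality. -/
def beq : Tm → Tm → Bool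
  | var m, var n => Nat.beq m n
  | univ m, univ n => Nat.beq m n
  | pi A B, pi A' B' => beq A A' && beq B B'
  | lam A B, lam A' B' => beq A A' && beq B B'
  | app A B, app A' B' => beq A A' && beq B B'
  | sig A B, sig A' B' => beq A A' && beq B B'
  | pair A B a b, pair A' B' a' b' => beq A A' && beq B B' && beq a a' && beq b b'
  | split C d p, split C' d' p' => beq C C' && beq d d' && beq p p'
  | idt C d p, idt C' d' p' => beq C C' && beq d d' && beq p p'
  | refl a, refl a' => beq a a'
  | idrec C d p, idrec C' d' p' => beq C C' && beq d d' && beq p p'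
  | funext f g h, funext f' g' h' => beq f f' && beq g g' && beq h h'
  | _, _ => false

theorem eq_of_beq {s t : Tm} (h : beq s t = true) : s = t := by
  induction s generalizing t <;> cases t <;> simp_all [beq] <;> grind

/-- `k t`, where `t` is evaluated completely before `k` is applied. -/
def eval {α : Type} : Tm → (Tm → α) → α
  | var m, k => k (var m)
  | univ m, k => k (univ m)
  | pi A B, k => eval A fun A => eval B fun B => k (pi A B)
  | lam A b, k => eval A fun A => eval b fun b => k (lam A b)
  | app f a, k => eval f fun f => eval a fun a => k (app f a)
  | sig A B, k => eval A fun A => eval B fun B => k (sig A B)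
  | pair A B a b, k =>
    eval A fun A => eval B fun B => eval a fun a => eval b fun b => k (pair A B a b)
  | split C d p, k => eval C fun C => eval d fun d => eval p fun p => k (split C d p)
  | idt A a b, k => eval A fun A => eval a fun a => eval b fun b => k (idt A a b)
  | refl a, k => eval a fun a => k (refl a)
  | idrec C d p, k => eval C fun C => eval d fun d => eval p fun p => k (idrec C d p)
  | funext f g h, k => eval f fun f => eval g fun g => eval h fun h => k (funext f g h)

@[simp]
theorem eval_eq {α : Type} (t : Tm) (k : Tm → α) : eval t k = k t := by
  induction t generalizing k <;> simp_all [eval]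

/-- Normalization, to a depth that is bounded by the first argument. -/
def nf : ℕ → Tm → Tm
  | 0, t => t
  | _ + 1, var m => var m
  | _ + 1, univ m => univ m
  | n + 1, pi A B => pi (nf n A) (nf n B)
  | n + 1, lam A b => lam (nf n A) (nf n b)
  | n + 1, app f a =>
    match nf n f with
    | lam _ b => nf n (inst b a)
    | f' => app f' (nf n a)
  | n + 1, sig A B => sig (nf n A) (nf n B)
  | n + 1, pair A B a b => pair (nf n A) (nf n B) (nf n a) (nf n b)
  | n + 1, split C d p =>
    match nf n p with
    | pair _ _ a b => nf n (inst₂ d a b)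
    | p' => split (nf n C) (nf n d) p'
  | n + 1, idt A a b => idt (nf n A) (nf n a) (nf n b)
  | n + 1, refl a => refl (nf n a)
  | n + 1, idrec C d p =>
    match nf n p with
    | refl _ => nf n d
    | p' => idrec (nf n C) (nf n d) p'
  | n + 1, funext f g h => funext (nf n f) (nf n g) (nf n h)

/-- No termination argument is needed: when the bound is exhausted the term is left as it is, which
is still convertible. -/
theorem conv_nf (n : ℕ) (t : Tm) : Conv t (nf n t) := by
  induction n generalizing t with
  | zero => exact .rfl _
  | succ n ih =>
    cases t with
    | var m => exact .rfl _
    | univ m => exact .rfl _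
    | pi A B => exact .pi (ih _) (ih _)
    | lam A b => exact .lam (ih _) (ih _)
    | app f a =>
      have hf := ih f
      simp only [nf]
      split
      · next h =>
        rw [h] at hf
        exact .trans (.app hf (.rfl _)) (.trans (.beta _ _ _) (ih _))
      · exact .app hf (ih _)
    | sig A B => exact .sig (ih _) (ih _)
    | pair A B a b => exact .pair (ih _) (ih _) (ih _) (ih _)
    | split C d p =>
      have hp := ih p
      simp only [nf]
      split
      · next h =>
        rw [h] at hp
        exact .trans (.split (.rfl _) (.rfl _) hp) (.trans (.split_pair _ _ _ _ _ _) (ih _))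
      · exact .split (ih _) (ih _) hp
    | idt A a b => exact .idt (ih _) (ih _) (ih _)
    | refl a => exact .refl (ih _)
    | idrec C d p =>
      have hp := ih p
      simp only [nf]
      split
      · next h =>
        rw [h] at hp
        exact .trans (.idrec (.rfl _) (.rfl _) hp) (.trans (.idrec_refl _ _ _) (ih _))
      · exact .idrec (ih _) (ih _) hp
    | funext f g h => exact .funext (ih _) (ih _) (ih _)

end Tm

/-- Computation rules never inspect universe levels, so conversions between symbolic terms hold for
all values of the levels. -/
theorem Conv.relevel (l : ℕ → ℕ) {s t : Tm} (h : Conv s t) :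
    Conv (s.relevel l) (t.relevel l) := by
  induction h with
  | rfl t => exact .rfl _
  | symm _ ih => exact ih.symm
  | trans _ _ ih ih' => exact ih.trans ih'
  | beta A b a => rw [relevel_inst]; exact .beta _ _ _
  | split_pair C d A B a b => rw [relevel_inst₂]; exact .split_pair _ _ _ _ _ _
  | idrec_refl C d a => exact .idrec_refl _ _ _
  | pi _ _ h₁ h₂ => exact .pi h₁ h₂
  | lam _ _ h₁ h₂ => exact .lam h₁ h₂
  | app _ _ h₁ h₂ => exact .app h₁ h₂
  | sig _ _ h₁ h₂ => exact .sig h₁ h₂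
  | pair _ _ _ _ h₁ h₂ h₃ h₄ => exact .pair h₁ h₂ h₃ h₄
  | split _ _ _ h₁ h₂ h₃ => exact .split h₁ h₂ h₃
  | idt _ _ _ h₁ h₂ h₃ => exact .idt h₁ h₂ h₃
  | refl _ h₁ => exact .refl h₁
  | idrec _ _ _ h₁ h₂ h₃ => exact .idrec h₁ h₂ h₃
  | funext _ _ _ h₁ h₂ h₃ => exact .funext h₁ h₂ h₃

theorem HasType.cumul_le {Γ : List Tm} {A : Tm} {i k : ℕ} (h : HasType Γ A (.univ i))
    (hik : i ≤ k) : HasType Γ A (.univ k) := by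
  induction hik with
  | refl => exact h
  | step _ ih => exact ih.cumul

/-- The type of a variable. -/
def lookup : List Tm → ℕ → Option Tm
  | [], _ => none
  | A :: _, 0 => some (wk 1 A)
  | _ :: Γ, n + 1 => (lookup Γ n).map (wk 1)

theorem HasVar.of_lookup (l : ℕ → ℕ) {Γ : List Tm} {n : ℕ} {A : Tm}
    (h : lookup Γ n = some A) : HasVar (Γ.map (relevel l)) n (A.relevel l) := by
  induction Γ generalizing n A with
  | nil => simp [lookup] at h
  | cons B Γ ih =>
    cases n with
    | zero =>
      simp only [lookup, Option.some.injEq] at h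
      subst h
      rw [relevel_wk]
      exact .zero _ _
    | succ n =>
      simp only [lookup, Option.map_eq_some_iff] at h
      obtain ⟨A, hA, rfl⟩ := h
      rw [relevel_wk]
      exact .succ _ (ih hA)

/-! ### Inference with bounded depth -/

section Inference

variable (n : ℕ) (inf : List Tm → Tm → Option Tm)

/-- The level of the universe that `A` belongs to, according to `inf`. -/
def universeOf (Γ : List Tm) (A : Tm) : Option ℕ :=
  match inf Γ A with
  | none => none
  | some U =>
    match nf n U with
    | univ a => some a
    | _ => none

/-- Whether `t`, which has type `B`, also has type `A`. -/
def subsumes (Γ : List Tm) (B A : Tm) : Bool :=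
  (match B, A with
    | univ b, univ a => levelLe b a
    | _, _ => false) ||
  (beq B A || (beq (nf n B) (nf n A) && (universeOf n inf Γ A).isSome))

/-- Whether `t` has type `A`, according to `inf`. -/
def checks (Γ : List Tm) (t A : Tm) : Bool :=
  match inf Γ t with
  | none => false
  | some B => subsumes n inf Γ B A

/-- A type of `t`, brought to head normal form if it does not start with a type former. -/
def inferHead (Γ : List Tm) (t : Tm) : Option Tm :=
  match inf Γ t with
  | none => none
  | some (pi A B) => some (pi A B)
  | some (sig A B) => some (sig A B)
  | some (idt A a b) => some (idt A a b)
  | some T => bif (universeOf n inf Γ (nf n T)).isSome then some (nf n T) else none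

/-- `some r` if `b` holds. -/
def guarded (b : Bool) (r : Tm) : Option Tm := bif b then some r else none

end Inference

/-- A type of the term `t`; the first argument bounds the depth of the search. -/
def infer : ℕ → List Tm → Tm → Option Tm
  | 0, _, _ => none
  | _ + 1, Γ, var m => lookup Γ m
  | _ + 1, _, univ a => some (univ (max a 2 + 1))
  | n + 1, Γ, pi A B =>
    match universeOf n (infer n) Γ A, universeOf n (infer n) (A :: Γ) B with
    | some a, some b => some (univ (levelSup a b))
    | _, _ => none
  | n + 1, Γ, lam A b =>
    match universeOf n (infer n) Γ A, infer n (A :: Γ) b with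
    | some _, some B => some (pi A B)
    | _, _ => none
  | n + 1, Γ, app f a =>
    match inferHead n (infer n) Γ f with
    | some (pi A B) => guarded (checks n (infer n) Γ a A) (inst B a)
    | _ => none
  | n + 1, Γ, sig A B =>
    match universeOf n (infer n) Γ A, universeOf n (infer n) (A :: Γ) B with
    | some a, some b => some (univ (levelSup a b))
    | _, _ => none
  | n + 1, Γ, pair A B a b =>
    match universeOf n (infer n) Γ A, universeOf n (infer n) (A :: Γ) B with
    | some _, some _ =>
      guarded (checks n (infer n) Γ a A && checks n (infer n) Γ b (inst B a)) (sig A B)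
    | _, _ => none
  | n + 1, Γ, split C d p =>
    match inferHead n (infer n) Γ p with
    | some (sig A B) =>
      guarded ((universeOf n (infer n) (sig A B :: Γ) C).isSome &&
        checks n (infer n) (B :: A :: Γ) d (instPair A B C)) (inst C p)
    | _ => none
  | n + 1, Γ, idt A a b =>
    match universeOf n (infer n) Γ A with
    | some i =>
      guarded (checks n (infer n) Γ a A && checks n (infer n) Γ b A) (univ i)
    | _ => none
  | n + 1, Γ, Tm.refl a =>
    match infer n Γ a with
    | some A => some (idt A a a)
    | none => none
  | n + 1, Γ, idrec C d p =>
    match inferHead n (infer n) Γ p with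
    | some (idt A a b) =>
      guarded ((universeOf n (infer n) (idt (wk 1 A) (wk 1 a) (var 0) :: A :: Γ) C).isSome &&
        checks n (infer n) Γ d (inst₂ C a (Tm.refl a))) (inst₂ C b p)
    | _ => none
  | n + 1, Γ, Tm.funext f g h =>
    match inferHead n (infer n) Γ f with
    | some (pi A B) =>
      guarded (checks n (infer n) Γ g (pi A B) && checks n (infer n) Γ h
        (pi A (idt B (app (wk 1 f) (var 0)) (app (wk 1 g) (var 0))))) (idt (pi A B) f g)
    | _ => none

/-! ### Soundness of inference -/

section Soundness

variable (i j : ℕ)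

/-- The judgment `Γ ⊢ t : A`, for symbolic universe levels. -/
def Judgment (Γ : List Tm) (t A : Tm) : Prop :=
  HasType (Γ.map (relevel (level i j))) (t.relevel (level i j)) (A.relevel (level i j))

/-- `inf` infers only derivable types. -/
def Sound (inf : List Tm → Tm → Option Tm) : Prop :=
  ∀ Γ t A, inf Γ t = some A → Judgment i j Γ t A

variable {i j} {n : ℕ} {inf : List Tm → Tm → Option Tm} {Γ : List Tm}

theorem Judgment.conv {t A B : Tm} {a : ℕ} (h : Judgment i j Γ t A)
    (hB : Judgment i j Γ B (univ a)) (hAB : Conv A B) : Judgment i j Γ t B :=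
  HasType.conv h hB (hAB.relevel _)

theorem Judgment.cumul {A : Tm} {a b : ℕ} (h : Judgment i j Γ A (univ a))
    (hab : levelLe a b = true) : Judgment i j Γ A (univ b) :=
  HasType.cumul_le h (level_le_of_levelLe i j hab)

theorem Judgment.univ (a : ℕ) : Judgment i j Γ (univ a) (univ (max a 2 + 1)) :=
  (HasType.univ _ _).cumul_le (level_lt_level_max_add_one i j a)

theorem Sound.universeOf (hs : Sound i j inf) {A : Tm} {a : ℕ}
    (h : universeOf n inf Γ A = some a) : Judgment i j Γ A (.univ a) := by
  unfold TypeTheory.universeOf at h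
  split at h
  · cases h
  · next U hU =>
    split at h
    · next b hb =>
      cases h
      exact (hs _ _ _ hU).conv (.univ a) (hb ▸ conv_nf n U)
    · cases h

theorem Sound.isSome_universeOf (hs : Sound i j inf) {A : Tm}
    (h : (TypeTheory.universeOf n inf Γ A).isSome = true) : ∃ a, Judgment i j Γ A (.univ a) := by
  obtain ⟨a, ha⟩ := Option.isSome_iff_exists.1 h
  exact ⟨a, hs.universeOf ha⟩

theorem Sound.subsumes (hs : Sound i j inf) {t A B : Tm} (ht : Judgment i j Γ t B)
    (h : subsumes n inf Γ B A = true) : Judgment i j Γ t A := by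
  simp only [TypeTheory.subsumes, Bool.or_eq_true, Bool.and_eq_true] at h
  rcases h with h | h | ⟨h, h'⟩
  · split at h
    · exact ht.cumul h
    · cases h
  · exact eq_of_beq h ▸ ht
  -- `Conv` is untyped, so the conversion rule needs `A` to be a type; syntactic equality above does
  -- not.
  · obtain ⟨a, ha⟩ := hs.isSome_universeOf h'
    exact ht.conv ha (.trans (eq_of_beq h ▸ conv_nf n B) (conv_nf n A).symm)

theorem Sound.checks (hs : Sound i j inf) {t A : Tm} (h : checks n inf Γ t A = true) :
    Judgment i j Γ t A := by
  unfold TypeTheory.checks at h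
  split at h
  · cases h
  · next B hB => exact hs.subsumes (hs _ _ _ hB) h

theorem Sound.inferHead (hs : Sound i j inf) {t A : Tm} (h : inferHead n inf Γ t = some A) :
    Judgment i j Γ t A := by
  unfold TypeTheory.inferHead at h
  split at h
  · cases h
  · next h' => cases h; exact hs _ _ _ h'
  · next h' => cases h; exact hs _ _ _ h'
  · next h' => cases h; exact hs _ _ _ h'
  · next T _ _ _ h' =>
    cases hu : (TypeTheory.universeOf n inf Γ (nf n T)).isSome
    · simp [hu] at h
    · simp only [hu, cond_true, Option.some.injEq] at h
      subst h
      obtain ⟨a, ha⟩ := hs.isSome_universeOf hu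
      exact (hs _ _ _ h').conv ha (conv_nf n T)

theorem guarded_eq_some {b : Bool} {r s : Tm} (h : guarded b r = some s) : b = true ∧ r = s := by
  cases b <;> simp_all [guarded]

/-- Each branch of `infer` is one typing rule whose premises were tested at the smaller bound.
Completeness plays no role: a failed search yields nothing. -/
theorem sound_infer (i j n : ℕ) : Sound i j (infer n) := by
  induction n with
  | zero => intro Γ t A h; simp [infer] at h
  | succ n hs =>
    intro Γ t T h
    cases t with
    | var m => exact .var (.of_lookup _ h)
    | univ a => cases h; exact .univ a
    | pi A B =>
      simp only [infer] at h
      split at h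
      · next a b ha hb =>
        cases h
        exact .pi ((hs.universeOf ha).cumul (levelLe_levelSup_left a b))
          ((hs.universeOf hb).cumul (levelLe_levelSup_right a b))
      · cases h
    | lam A b =>
      simp only [infer] at h
      split at h
      · next a B ha hb =>
        cases h
        exact .lam (hs.universeOf ha) (hs _ _ _ hb)
      · cases h
    | app f a =>
      simp only [infer] at h
      split at h
      · next A B hf =>
        obtain ⟨ha, rfl⟩ := guarded_eq_some h
        unfold Judgment
        rw [relevel_inst]
        exact .app (hs.inferHead hf) (hs.checks ha)
      · cases h
    | sig A B =>
      simp only [infer] at h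
      split at h
      · next a b ha hb =>
        cases h
        exact .sig ((hs.universeOf ha).cumul (levelLe_levelSup_left a b))
          ((hs.universeOf hb).cumul (levelLe_levelSup_right a b))
      · cases h
    | pair A B a b =>
      simp only [infer] at h
      split at h
      · next k m hA hB =>
        obtain ⟨hc, rfl⟩ := guarded_eq_some h
        obtain ⟨ha, hb⟩ := (Bool.and_eq_true _ _).mp hc
        have hb := hs.checks hb
        unfold Judgment at hb
        rw [relevel_inst] at hb
        exact .pair ((hs.universeOf hA).cumul (levelLe_levelSup_left k m))
          ((hs.universeOf hB).cumul (levelLe_levelSup_right k m)) (hs.checks ha) hb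
      · cases h
    | split C d p =>
      simp only [infer] at h
      split at h
      · next A B hp =>
        obtain ⟨hc, rfl⟩ := guarded_eq_some h
        obtain ⟨hC, hd⟩ := (Bool.and_eq_true _ _).mp hc
        obtain ⟨k, hC⟩ := hs.isSome_universeOf hC
        have hd := hs.checks hd
        unfold Judgment at hd ⊢
        rw [relevel_instPair] at hd
        rw [relevel_inst]
        exact .split hC hd (hs.inferHead hp)
      · cases h
    | idt A a b =>
      simp only [infer] at h
      split at h
      · next k hA =>
        obtain ⟨hc, rfl⟩ := guarded_eq_some h
        obtain ⟨ha, hb⟩ := (Bool.and_eq_true _ _).mp hc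
        exact .idt (hs.universeOf hA) (hs.checks ha) (hs.checks hb)
      · cases h
    | refl a =>
      simp only [infer] at h
      split at h
      · next A ha => cases h; exact .refl (hs _ _ _ ha)
      · cases h
    | idrec C d p =>
      simp only [infer] at h
      split at h
      · next A a b hp =>
        obtain ⟨hc, rfl⟩ := guarded_eq_some h
        obtain ⟨hC, hd⟩ := (Bool.and_eq_true _ _).mp hc
        obtain ⟨k, hC⟩ := hs.isSome_universeOf hC
        have hd := hs.checks hd
        unfold Judgment at hC hd ⊢
        rw [relevel_inst₂] at hd
        rw [relevel_inst₂]
        simp only [List.map_cons, relevel, relevel_wk] at hC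
        exact .idrec hC hd (hs.inferHead hp)
      · cases h
    | funext f g k =>
      simp only [infer] at h
      split at h
      · next A B hf =>
        obtain ⟨hc, rfl⟩ := guarded_eq_some h
        obtain ⟨hg, hk⟩ := (Bool.and_eq_true _ _).mp hc
        have hk := hs.checks hk
        unfold Judgment at hk
        simp only [relevel, relevel_wk] at hk
        exact .funext (hs.inferHead hf) (hs.checks hg) hk
      · cases h

end Soundness

/-! ### Terms with named variables -/

/-- A term in a context of unspecified length: `under n` is the term in a context of length `n`. -/
structure Expr : Type where
  /-- the term in a context of the given length -/
  under : ℕ → Tm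

namespace Expr

instance : CoeFun Expr fun _ => Expr → Expr :=
  ⟨fun f a => ⟨fun n => .app (f.under n) (a.under n)⟩⟩

/-- The `k`-th variable, counted from the outermost one. -/
def ref (k : ℕ) : Expr := ⟨fun n => .var (n - (k + 1))⟩

/-- `Π (x : A), B x` -/
def pi (A : Expr) (B : Expr → Expr) : Expr :=
  ⟨fun n => .pi (A.under n) ((B (ref n)).under (n + 1))⟩

/-- `λ (x : A), b x` -/
def lam (A : Expr) (b : Expr → Expr) : Expr :=
  ⟨fun n => .lam (A.under n) ((b (ref n)).under (n + 1))⟩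

/-- `Σ (x : A), B x` -/
def sig (A : Expr) (B : Expr → Expr) : Expr :=
  ⟨fun n => .sig (A.under n) ((B (ref n)).under (n + 1))⟩

/-- `(a, b) : Σ (x : A), B x` -/
def pair (A : Expr) (B : Expr → Expr) (a b : Expr) : Expr :=
  ⟨fun n => .pair (A.under n) ((B (ref n)).under (n + 1)) (a.under n) (b.under n)⟩

/-- The element of `C p` defined by `d x y : C (x, y)`. -/
def split (C : Expr → Expr) (p : Expr) (d : Expr → Expr → Expr) : Expr :=
  ⟨fun n => .split ((C (ref n)).under (n + 1)) ((d (ref n) (ref (n + 1))).under (n + 2)) (p.under n)⟩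

/-- `a =_A b` -/
def id (A a b : Expr) : Expr := ⟨fun n => .idt (A.under n) (a.under n) (b.under n)⟩

/-- `refl_a` -/
def refl (a : Expr) : Expr := ⟨fun n => .refl (a.under n)⟩

/-- The element of `C b p`, for `p : a = b`, defined by `d : C a refl_a`. -/
def J (C : Expr → Expr → Expr) (p d : Expr) : Expr :=
  ⟨fun n => .idrec ((C (ref n) (ref (n + 1))).under (n + 2)) (d.under n) (p.under n)⟩

/-- `f = g` from `h x : f x = g x` -/
def funext (f g A : Expr) (h : Expr → Expr) : Expr :=
  ⟨fun n => .funext (f.under n) (g.under n) ((lam A h).under n)⟩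

/-- `let x : A := a; b x` -/
def letIn (A a : Expr) (b : Expr → Expr) : Expr := lam A b a

/-- The universe of symbolic level `k`. -/
def univ (k : ℕ) : Expr := ⟨fun _ => .univ k⟩

/-- `A × B` -/
def prod (A B : Expr) : Expr := sig A fun _ => B

/-- `A → B` -/
def arrow (A B : Expr) : Expr := pi A fun _ => B

/-- First projection. -/
def fst (A p : Expr) : Expr := split (fun _ => A) p fun a _ => a

/-- Second projection out of `Σ (x : A), B x`. -/
def snd (A : Expr) (B : Expr → Expr) (p : Expr) : Expr :=
  split (fun p => B (fst A p)) p fun _ b => b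

/-! #### Paths -/

/-- `p⁻¹ : b = a`, for `p : a = b` -/
def inv (A a p : Expr) : Expr := J (fun y _ => id A y a) p (refl a)

/-- `p ⬝ q : a = c`, for `p : a = b` and `q : b = c` -/
def trans (A a p q : Expr) : Expr := J (fun y _ => id A a y) q p

/-- `f a = f b`, for `p : a = b` -/
def ap (B : Expr) (f : Expr → Expr) (a p : Expr) : Expr :=
  J (fun y _ => id B (f a) (f y)) p (refl (f a))

/-- The element of `P b` given by `d : P a` and `p : a = b`. -/
def transport (P : Expr → Expr) (p d : Expr) : Expr := J (fun y _ => P y) p d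

/-! #### Propositions and equivalences -/

/-- `Π (x y : A), x = y` -/
def isProp (A : Expr) : Expr := ⟨fun n => TypeTheory.isProp (A.under n)⟩

/-- `Σ (c : A), Π (x : A), c = x` -/
def isContr (A : Expr) : Expr := ⟨fun n => TypeTheory.isContr (A.under n)⟩

/-- `Π (x : A), c = x` -/
def contraction (A c : Expr) : Expr := pi A fun x => id A c x

/-- `Σ (a : A), f a = b` -/
def fiber (A B f b : Expr) : Expr :=
  ⟨fun n => TypeTheory.fiber (A.under n) (B.under n) (f.under n) (b.under n)⟩

/-- `f : A → B` is an equivalence. -/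
def isEquiv (A B f : Expr) : Expr :=
  ⟨fun n => TypeTheory.isEquiv (A.under n) (B.under n) (f.under n)⟩

/-- A contractible type is a proposition. -/
def isPropOfIsContr (A w : Expr) : Expr :=
  split (fun _ => isProp A) w fun c h =>
    lam A fun x => lam A fun y => trans A x (inv A c (h x)) (h y)

/-- A product of propositions is a proposition. -/
def isPropPi (A : Expr) (B h : Expr → Expr) : Expr :=
  lam (pi A B) fun f => lam (pi A B) fun g => funext f g A fun x => h x (f x) (g x)

/-- A product of two propositions is a proposition. -/
def isPropProd : Expr :=
  lam (univ 2) fun A => lam (univ 2) fun B => lam (isProp A) fun hA => lam (isProp B) fun hB =>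
    let P := prod A B
    let mk := pair A fun _ => B
    lam P fun u => lam P fun v =>
      -- There is no judgmental η for `Σ`, so both elements are first replaced by pairs.
      split (fun u => id P u v) u fun a b => split (fun v => id P (mk a b) v) v fun a' b' =>
        J (fun y _ => id P (mk a b) (mk y b')) (hA a a') (ap P (mk a) b (hB b b'))

/-- `Π (a : A), B a → C a → D a` -/
def piTriple (A B C : Expr) (D : Expr → Expr → Expr → Expr) : Expr :=
  pi A fun a => pi (B a) fun b => pi (C a) fun c => D a b c

/-- `Σ (a : A), B a × C a` is a proposition if all functions on triples are constant. -/
def isPropTriple : Expr :=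
  lam (univ 2) fun A => lam (arrow A (univ 2)) fun B => lam (arrow A (univ 1)) fun C =>
    lam (pi (univ 2) fun T => pi (piTriple A B C fun _ _ _ => T) fun f =>
      piTriple A B C fun a b c => piTriple A B C fun a' b' c' => id T (f a b c) (f a' b' c'))
      fun h =>
        let D := fun a => prod (B a) (C a)
        let T := sig A D
        let mk := fun a b c => pair A D a (pair (B a) (fun _ => C a) b c)
        lam T fun u => lam T fun v =>
          split (fun u => id T u v) u fun a d => split (fun d => id T (pair A D a d) v) d fun b c =>
            split (fun v => id T (mk a b c) v) v fun a' d' =>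
              split (fun d' => id T (mk a b c) (pair A D a' d')) d' fun b' c' =>
                -- The hypothesis is used for the triple constructor itself.
                h T (lam A fun a => lam (B a) fun b => lam (C a) fun c => mk a b c) a b c a' b' c'

/-- `(h c)⁻¹ ⬝ h x = q` for every path `q : c = x`, where `h` is a contraction to `c`. -/
def pathOfContraction (A c h q : Expr) : Expr :=
  let t := fun y => trans A c (inv A c (h c)) (h y)
  J (fun y q => id (id A c y) (t y) q) q
    -- The case `q = refl`: the loop `h c` is generalized to a path `r : c = y`, which admits path
    -- induction.
    (J (fun y r => id (id A y y) (trans A y (inv A c r) r) (refl y)) (h c) (refl (refl c)))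

/-- Being contractible is a proposition. -/
def isPropIsContr (A : Expr) : Expr :=
  let K := isContr A
  let mk := pair A (contraction A)
  lam K fun u => lam K fun v =>
    split (fun u => id K u v) u fun c h => split (fun v => id K (mk c h) v) v fun c' h' =>
      -- By `r`, all paths from `c` to `x` agree with a canonical one; hence any two contractions to
      -- `c` agree pointwise.
      letIn
        (pi A fun x => pi (id A c x) fun q => id (id A c x) (trans A c (inv A c (h c)) (h x)) q)
        (lam A fun x => lam (id A c x) fun q => pathOfContraction A c h q)
        fun r =>
          -- The motive quantifies over `k` because the type of `h'` depends on the centre `c'`,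
          -- which is moved to `c`.
          J (fun y _ => pi (contraction A y) fun k => id K (mk c h) (mk y k)) (h c')
            (lam (contraction A c) fun k =>
              ap K (mk c) h (funext h k A fun x =>
                trans (id A c x) (h x)
                  (inv (id A c x) (trans A c (inv A c (h c)) (h x)) (r x (h x))) (r x (k x))))
            h'

/-- Being an equivalence is a proposition, if being contractible is one. -/
def isPropIsEquiv (hc A B f : Expr) : Expr :=
  isPropPi B (fun b => isContr (fiber A B f b)) fun b => hc (fiber A B f b)

/-- `a = a'` from `p : f a = f a'`, for an equivalence `f` with `w : isEquiv f`. -/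
def injective (A B f w a a' p : Expr) : Expr :=
  let mk := pair A fun x => id B (f x) (f a')
  -- Both `(a, p)` and `(a', refl)` lie in the contractible fibre over `f a'`.
  ap A (fst A) (mk a p)
    (isPropOfIsContr (fiber A B f (f a')) (w (f a')) (mk a p) (mk a' (refl (f a'))))

/-- The identity function is an equivalence. -/
def isEquivId (A : Expr) : Expr :=
  let one := lam A fun x => x
  let mk := fun b => pair A fun x => id A (one x) b
  lam A fun b =>
    let F := fiber A A one b
    pair F (contraction F) (mk b b (refl b)) (lam F fun w =>
      split (fun w => id F (mk b b (refl b)) w) w fun a p =>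
        -- The fibre of the identity over `b` consists of paths ending at `b`, so the induction
        -- moves `b` to `a`.
        J (fun y q => id (fiber A A one y) (mk y y (refl y)) (mk y a q)) p
          (refl (mk a a (refl a))))

/-- A function `f` with `h x : f x = x` is an equivalence. -/
def isEquivOfEqId : Expr :=
  lam (univ 2) fun A => lam (arrow A A) fun f => lam (pi A fun x => id A (f x) x) fun h =>
    transport (isEquiv A A) (funext (lam A fun x => x) f A fun x => inv A (f x) (h x))
      (isEquivId A)

/-- The type of `isEquivOfEqId`. -/
def isEquivOfEqIdType : Expr :=
  pi (univ 2) fun A => pi (arrow A A) fun f => arrow (pi A fun x => id A (f x) x) (isEquiv A A f)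

/-! ### Wild semicategories with named variables -/

/-- The data of a wild semicategory. -/
structure Cat : Type where
  /-- the objects -/
  ob : Expr
  /-- the morphisms -/
  hom : Expr
  /-- the composition -/
  comp : Expr
  /-- the associativity of the composition -/
  assoc : Expr

namespace Cat

/-- The underlying data in a context of length `n`. -/
def under (C : Cat) (n : ℕ) : Semicat := ⟨C.ob.under n, C.hom.under n, C.comp.under n⟩

/-- `λ C, b C` -/
def lam (b : Cat → Expr) : Expr :=
  ⟨fun n => .lam (.univ 0) (.lam (TypeTheory.arrow (.var 0) (TypeTheory.arrow (.var 0) (.univ 1)))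
    (.lam (compType (.var 1) (.var 0)) (.lam (assocType ⟨.var 2, .var 1, .var 0⟩)
      ((b ⟨ref n, ref (n + 1), ref (n + 2), ref (n + 3)⟩).under (n + 4)))))⟩

variable (C : Cat)

/-- `hom(x, y)` -/
def Hom (x y : Expr) : Expr := C.hom x y

/-- `g ∘ f`, for `f : hom(x, y)` and `g : hom(y, z)` -/
def cmp (x y z g f : Expr) : Expr := C.comp x y z g f

/-- `(– ∘ e) : hom(y, z) → hom(x, z)`, for `e : hom(x, y)` -/
def precomp (x y z e : Expr) : Expr := Expr.lam (C.Hom y z) fun g => C.cmp x y z g e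

/-- `(e ∘ –) : hom(w, x) → hom(w, y)`, for `e : hom(x, y)` -/
def postcomp (w x y e : Expr) : Expr := Expr.lam (C.Hom w x) fun f => C.cmp w x y e f

/-- `Π (z : Ob), isEquiv (– ∘ e : hom(y, z) → hom(x, z))` -/
def preEquiv (x y e : Expr) : Expr :=
  ⟨fun n => (C.under n).preEquiv (x.under n) (y.under n) (e.under n)⟩

/-- `Π (w : Ob), isEquiv (e ∘ – : hom(w, x) → hom(w, y))` -/
def postEquiv (x y e : Expr) : Expr :=
  ⟨fun n => (C.under n).postEquiv (x.under n) (y.under n) (e.under n)⟩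

/-- `e : hom(x, y)` is an equivalence. -/
def isEqv (x y e : Expr) : Expr := prod (C.preEquiv x y e) (C.postEquiv x y e)

/-- `i ∘ i = i` -/
def isIdem (x i : Expr) : Expr := id (C.Hom x x) (C.cmp x x x i i) i

/-- `i` is a good identity on `x`. -/
def isGoodId (x i : Expr) : Expr := prod (C.isEqv x x i) (C.isIdem x i)

/-- `Π (w : Ob) (f : hom(w, x)), i ∘ f = f` -/
def isLeftNeutral (x i : Expr) : Expr :=
  pi C.ob fun w => pi (C.Hom w x) fun f => id (C.Hom w x) (C.cmp w x x i f) f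

/-- `Π (y : Ob) (g : hom(x, y)), g ∘ i = g` -/
def isRightNeutral (x i : Expr) : Expr :=
  pi C.ob fun y => pi (C.Hom x y) fun g => id (C.Hom x y) (C.cmp x x y g i) g

/-- `i` is two-sided neutral. -/
def isNeutral (x i : Expr) : Expr := prod (C.isLeftNeutral x i) (C.isRightNeutral x i)

/-- `(– ∘ e) : hom(y, z) → hom(x, z)` is an equivalence, for `p : iseqv(e)`. -/
def preEquivOf (x y e p z : Expr) : Expr := fst (C.preEquiv x y e) p z

/-- `(e ∘ –) : hom(w, x) → hom(w, y)` is an equivalence, for `p : iseqv(e)`. -/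
def postEquivOf (x y e p w : Expr) : Expr :=
  snd (C.preEquiv x y e) (fun _ => C.postEquiv x y e) p w

/-! ### Equivalences and neutral morphisms -/

/-- Being an equivalence is a proposition. -/
def isPropIsEqv (x y e : Expr) : Expr :=
  -- Bound as a variable, the proof is written once and serves all the fibres.
  letIn (pi (univ 2) fun A => isProp (isContr A)) (Expr.lam (univ 2) isPropIsContr) fun hc =>
    isPropProd (C.preEquiv x y e) (C.postEquiv x y e)
      (isPropPi C.ob (fun z => isEquiv (C.Hom y z) (C.Hom x z) (C.precomp x y z e))
        fun z => isPropIsEquiv hc (C.Hom y z) (C.Hom x z) (C.precomp x y z e))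
      (isPropPi C.ob (fun w => isEquiv (C.Hom w x) (C.Hom w y) (C.postcomp w x y e))
        fun w => isPropIsEquiv hc (C.Hom w x) (C.Hom w y) (C.postcomp w x y e))

/-- Given `e : hom(x, y)` with `p : iseqv(e)`, an `i : hom(x, x)` with `q : e ∘ i = e` is left
neutral. -/
def leftNeutralOf (x y e p i q : Expr) : Expr :=
  Expr.lam C.ob fun w => Expr.lam (C.Hom w x) fun f =>
    injective (C.Hom w x) (C.Hom w y) (C.postcomp w x y e) (C.postEquivOf x y e p w)
      (C.cmp w x x i f) f
      -- `e ∘ (i ∘ f) = (e ∘ i) ∘ f = e ∘ f`, from which `injective` cancels `e`.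
      (trans (C.Hom w y) (C.cmp w x y e (C.cmp w x x i f))
        (inv (C.Hom w y) (C.cmp w x y (C.cmp x x y e i) f) (C.assoc w x x y e i f))
        (ap (C.Hom w y) (fun k => C.cmp w x y k f) (C.cmp x x y e i) q))

/-- Given `e : hom(x, y)` with `p : iseqv(e)`, an `i : hom(x, x)` with `q : e ∘ i = e` is right
neutral. -/
def rightNeutralOf (x y e p i q : Expr) : Expr :=
  Expr.lam C.ob fun z => Expr.lam (C.Hom x z) fun g =>
    let F := fiber (C.Hom y z) (C.Hom x z) (C.precomp x y z e) g
    let P := fun h => id (C.Hom x z) (C.precomp x y z e h) g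
    let c := fst F (C.preEquivOf x y e p z g)
    let h := fst (C.Hom y z) c
    -- Induction on the path `h ∘ e = g` replaces `g` by `h ∘ e`; then `(h ∘ e) ∘ i = h ∘ (e ∘ i) =
    -- h ∘ e`.
    J (fun g _ => id (C.Hom x z) (C.cmp x x z g i) g) (snd (C.Hom y z) P c)
      (trans (C.Hom x z) (C.cmp x x z (C.cmp x y z h e) i) (C.assoc x x y z h e i)
        (ap (C.Hom x z) (fun k => C.cmp x y z h k) (C.cmp x x y e i) q))

/-- An `i : hom(x, x)` with `e ∘ i = e` for some equivalence `e` is two-sided neutral. -/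
def neutralOf (x y e p i q : Expr) : Expr :=
  pair (C.isLeftNeutral x i) (fun _ => C.isRightNeutral x i)
    (C.leftNeutralOf x y e p i q) (C.rightNeutralOf x y e p i q)

/-- A two-sided neutral `i` is a good identity. -/
def goodIdOfNeutral (x i n : Expr) : Expr :=
  let L := C.isLeftNeutral x i
  let R := C.isRightNeutral x i
  letIn isEquivOfEqIdType isEquivOfEqId fun h =>
    pair (C.isEqv x x i) (fun _ => C.isIdem x i)
      (pair (C.preEquiv x x i) (fun _ => C.postEquiv x x i)
        (Expr.lam C.ob fun z => h (C.Hom x z) (C.precomp x x z i) (snd L (fun _ => R) n z))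
        (Expr.lam C.ob fun w => h (C.Hom w x) (C.postcomp w x x i) (fst L n w)))
      -- Idempotence is left neutrality at `f = i`.
      (fst L n x i)

/-! ### Uniqueness of good identities, and the three closed terms -/

/-- `Σ (i : hom(x, x)), iseqv(i) × (i ∘ i = i)` -/
def GoodId (x : Expr) : Expr := sig (C.Hom x x) (C.isGoodId x)

/-- `Π (j : hom(x, x)), iseqv(j) → (j ∘ j = j) → B j` -/
def piGoodId (x : Expr) (B : Expr → Expr → Expr → Expr) : Expr :=
  pi (C.Hom x x) fun j => pi (C.isEqv x x j) fun e => pi (C.isIdem x j) fun q => B j e q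

/-- `λ (j : hom(x, x)) (e : iseqv(j)) (q : j ∘ j = j), b j e q` -/
def lamGoodId (x : Expr) (b : Expr → Expr → Expr → Expr) : Expr :=
  Expr.lam (C.Hom x x) fun j => Expr.lam (C.isEqv x x j) fun e => Expr.lam (C.isIdem x j) fun q =>
    b j e q

/-- For a right neutral equivalence `i` and every good identity `j`, a function `f` of good
identities has the same value at `i` as at `j`: in the contractible fibre of `j ∘ –` over `j`, the
elements `i` and `j` are equal. -/
def eqAtGoodId (x i p r T f j e q : Expr) : Expr :=
  let H := C.Hom x x
  let c := f i p (r x i)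
  let P := fun j u => id H (C.cmp x x x j u) j
  let F := fiber H H (C.postcomp x x x j) j
  let along := fun j s => transport (P j) s (r x j)
  split (fun _ => id T c (f j e q))
    -- The path from `(i, r x j)` to `(j, q)` in the fibre is decomposed into `s : i = j` and a path
    -- over `s`.
    (J (fun v _ => sig (id H i (fst H v)) fun s => id (P j (fst H v)) (along j s) (snd H (P j) v))
      (isPropOfIsContr F (C.postEquivOf x x j e x j) (pair H (P j) i (r x j)) (pair H (P j) j q))
      (pair (id H i i) (fun s => id (P j i) (along j s) (r x j)) (refl i) (refl (r x j))))
    fun s t =>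
      -- Induction on `s` turns `j` into `i`, also in `r x j`; so `t` becomes a path `r x i = q`.
      -- The data depending on `j` are generalized first.
      J (fun j s => pi (C.isEqv x x j) fun e => pi (C.isIdem x j) fun q =>
          arrow (id (C.isIdem x j) (along j s) q) (id T c (f j e q))) s
        (Expr.lam (C.isEqv x x i) fun e => Expr.lam (C.isIdem x i) fun q =>
          Expr.lam (id (C.isIdem x i) (r x i) q) fun t =>
            J (fun q _ => id T c (f i e q)) t
              (ap T (fun e => f i e (r x i)) p (C.isPropIsEqv x x i p e)))
        e q t

/-- Functions of good identities are constant. -/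
def eqOfGoodId (x : Expr) : Expr :=
  Expr.lam (univ 2) fun T => Expr.lam (C.piGoodId x fun _ _ _ => T) fun f =>
    C.lamGoodId x fun i p q =>
      -- Here `e = i`, and the equation `e ∘ i = e` is idempotence.
      letIn (C.isRightNeutral x i) (C.rightNeutralOf x x i p i q) fun r =>
        let c := f i p (r x i)
        letIn (C.piGoodId x fun j e q => id T c (f j e q))
          (C.lamGoodId x fun j e q => C.eqAtGoodId x i p r T f j e q) fun h =>
            -- The reference value `c` uses `r x i`, not the given `q`; so `(i, p, q)` too is
            -- compared with `c`.
            C.lamGoodId x fun j e q' => trans T (f i p q) (inv T c (h i p q)) (h j e q')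

/-- Having a good identity on `x` is a proposition. -/
def isPropGoodId (x : Expr) : Expr :=
  isPropTriple (C.Hom x x) (Expr.lam (C.Hom x x) (C.isEqv x x)) (Expr.lam (C.Hom x x) (C.isIdem x))
    (C.eqOfGoodId x)

/-- Having a good identity structure is a proposition. -/
def isPropHasGoodIdStruc : Expr :=
  isPropPi C.ob C.GoodId C.isPropGoodId

/-- Good identities are two-sided neutral, and conversely. -/
def goodIdIffNeutral : Expr :=
  Expr.lam C.ob fun x => Expr.lam (C.Hom x x) fun i =>
    let G := C.isGoodId x i
    let N := C.isNeutral x i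
    pair (arrow G N) (fun _ => arrow N G)
      (Expr.lam G fun g => C.neutralOf x x i (fst (C.isEqv x x i) g) i
        (snd (C.isEqv x x i) (fun _ => C.isIdem x i) g))
      (Expr.lam N fun n => C.goodIdOfNeutral x i n)

/-- `I(e)` is a good identity, for every equivalence `e`. -/
def goodIdOfEqv : Expr :=
  Expr.lam C.ob fun x => Expr.lam C.ob fun y => Expr.lam (C.Hom x y) fun e =>
    Expr.lam (C.isEqv x y e) fun p =>
      let H := C.Hom x x
      let f := C.postcomp x x y e
      let F := fiber H (C.Hom x y) f e
      letIn F (fst F (C.postEquivOf x y e p x e)) fun c =>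
        let i := fst H c
        letIn (C.isNeutral x i)
          -- The second component of the centre `c` is the equation `e ∘ I(e) = e`.
          (C.neutralOf x y e p i (snd H (fun a => id (C.Hom x y) (f a) e) c))
          (C.goodIdOfNeutral x i)

end Cat

end Expr

/-! ### Running the checker -/

open TypeTheory.Expr

/-- Whether the checker accepts `t` as a closed term of type `T`. -/
def accepts (n : ℕ) (t T : Tm) : Bool :=
  eval t fun t => eval T fun T => checks n (infer n) [] t T

theorem inhabited_of_accepts (i j n : ℕ) {t T : Tm} (h : accepts n t T = true) :
    Inhabited (T.relevel (level i j)) := by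
  simp only [accepts, eval_eq] at h
  exact ⟨_, (sound_infer i j n).checks h⟩

/-- The `0` and `1` in `T` are symbols, which `relevel (level i j)` turns into `i` and `j`; `70` is
a sufficient depth for the search. -/
theorem inhabited_isProp_hasGoodIdStruc (i j : ℕ) :
    Inhabited (forallSemicat i j fun C => TypeTheory.isProp C.hasGoodIdStruc) :=
  inhabited_of_accepts i j 70 (t := (Cat.lam Cat.isPropHasGoodIdStruc).under 0)
    (T := forallSemicat 0 1 fun C => TypeTheory.isProp C.hasGoodIdStruc) (by decide +kernel)

theorem inhabited_goodIdIffNeutral (i j : ℕ) :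
    Inhabited (forallSemicat i j fun C => C.goodIdIffNeutral) :=
  inhabited_of_accepts i j 70 (t := (Cat.lam Cat.goodIdIffNeutral).under 0)
    (T := forallSemicat 0 1 fun C => C.goodIdIffNeutral) (by decide +kernel)

theorem inhabited_goodIdOfEqv (i j : ℕ) :
    Inhabited (forallSemicat i j fun C => C.goodIdOfEqv) :=
  inhabited_of_accepts i j 70 (t := (Cat.lam Cat.goodIdOfEqv).under 0)
    (T := forallSemicat 0 1 fun C => C.goodIdOfEqv) (by decide +kernel)

end TypeTheory

theorem mainTheorem1 (i j : ℕ) :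
    TypeTheory.Inhabited
        (TypeTheory.forallSemicat i j fun C => TypeTheory.isProp C.hasGoodIdStruc) ∧
      TypeTheory.Inhabited
        (TypeTheory.forallSemicat i j fun C => C.goodIdIffNeutral) ∧
      TypeTheory.Inhabited
        (TypeTheory.forallSemicat i j fun C => C.goodIdOfEqv) :=
  ⟨TypeTheory.inhabited_isProp_hasGoodIdStruc i j, TypeTheory.inhabited_goodIdIffNeutral i j,
    TypeTheory.inhabited_goodIdOfEqv i j⟩
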